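/- Let $k\ge 1$ be an integer and let $\sigma$ be a probability measure on $\mathbb{R}$ with $\int |x|^k\,d\sigma(x)<\infty$. A quadrature formula of degree at least $k$ for $\sigma$ consists of nodes $x_1,\dots,x_n\in\mathbb{R}$ and weights $w_1,\dots,w_n\ge 0$ with $\int x^j\,d\sigma(x)=\sum_{i=1}^n w_i x_i^j$ for all integers $0\le j\le k$; it is identified with the measure $\sum_i w_i\delta_{x_i}$. It is a Chebyshev-type quadrature with $n$ nodes if all $w_i=1/n$, i.e. $\int x^j\,d\sigma(x)=\frac1n\sum_{i=1}^n x_i^j$ for $0\le j\le k$, where the nodes need not be distinct. Let $n^0_\sigma(k)$ be the minimal $n$ such that a Chebyshev-type quadrature of degree at least $k$ with $n$ nodes exists (and $\infty$ if there is none), and let $n_\sigma(k)$ be the minimal integer $N$ such that for every $n\ge N$ there is a Chebyshev-type quadrature of degree at least $k$ with exactly $n$ nodes (and $\infty$ if there is no such $N$). 1. Suppose that $\sigma$ is purely atomic with $m$ atoms, $m<\infty$, and $k\ge 2m$. Then the only quadrature formula of degree at least $k$ for $\sigma$ is $\sigma$ itself. If moreover $\sigma$ has an atom of irrational weight, then $n^0_\sigma(k)=n_\sigma(k)=\infty$.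 If all atoms of $\sigma$ have rational weights, then $n^0_\sigma(k)<\infty$, while $n_\sigma(k)=\infty$ if $m\ge 2$ and $n_\sigma(k)=1$ if $m=1$. 2. Suppose that $\sigma$ has a non-atomic component, or that it is purely atomic with $m$ atoms, $m\in\{1,2,\dots\}\cup\{\infty\}$, and $k<2m$. Then $n_\sigma(k)<\infty$. Furthermore, there is $n_0\in\mathbb{N}$ such that for every $n\ge n_0$ there is a Chebyshev-type quadrature of degree at least $k$ for $\sigma$ with $n$ distinct nodes. -/

import Mathlib

open MeasureTheory

namespace CTQ

/-- The quadrature formula with nodes `x i` and non-negative weights `w i` (zero weights and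
repeated nodes are allowed) has algebraic degree at least `k` for `σ`. -/
structure IsQuadratureFormula (σ : Measure ℝ) (k : ℕ) {n : ℕ} (x w : Fin n → ℝ) : Prop where
  weight_nonneg : ∀ i, 0 ≤ w i
  moment_eq : ∀ j : ℕ, j ≤ k → ∫ t, t ^ j ∂σ = ∑ i, w i * x i ^ j

/-- The discrete measure `∑ i, w i • δ_{x i}` that a quadrature formula stands for. -/
noncomputable def discreteMeasure {n : ℕ} (x w : Fin n → ℝ) : Measure ℝ :=
  ∑ i, ENNReal.ofReal (w i) • Measure.dirac (x i)

/-- The set of all quadrature formulas of degree at least `k` for `σ`, as measures. -/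
def quadratureMeasures (σ : Measure ℝ) (k : ℕ) : Set (Measure ℝ) :=
  {μ | ∃ (n : ℕ) (x w : Fin n → ℝ), IsQuadratureFormula σ k x w ∧ μ = discreteMeasure x w}

/-- The (not necessarily distinct) nodes `x i`, `i < n`, form a Chebyshev-type quadrature of degree
at least `k` for `σ`. For a probability measure the case `j = 0` forces `n ≥ 1`. -/
def IsChebyshevType (σ : Measure ℝ) (k : ℕ) {n : ℕ} (x : Fin n → ℝ) : Prop :=
  ∀ j : ℕ, j ≤ k → ∫ t, t ^ j ∂σ = (1 / (n : ℝ)) * ∑ i, x i ^ j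

/-- There is a Chebyshev-type quadrature with exactly `n` nodes, counted with multiplicity. -/
def ExistsChebyshevType (σ : Measure ℝ) (k n : ℕ) : Prop :=
  ∃ x : Fin n → ℝ, IsChebyshevType σ k x

/-- `n⁰_σ(k)`: the minimal number of nodes; it is `⊤` if there is no such quadrature. -/
noncomputable def minNodes (σ : Measure ℝ) (k : ℕ) : ℕ∞ :=
  ⨅ (n : ℕ) (_ : ExistsChebyshevType σ k n), (n : ℕ∞)

/-- `n_σ(k)`: the minimal `N` such that every `n ≥ N` occurs as a number of nodes; it is `⊤` if
there is no such `N`. -/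
noncomputable def minNodesFrom (σ : Measure ℝ) (k : ℕ) : ℕ∞ :=
  ⨅ (N : ℕ) (_ : ∀ n : ℕ, N ≤ n → ExistsChebyshevType σ k n), (N : ℕ∞)

/-- The atoms of a measure on the line. -/
def atoms (σ : Measure ℝ) : Set ℝ := {x | σ {x} ≠ 0}

/-- `σ` has no non-atomic component: it is carried by its atoms. -/
def IsPurelyAtomic (σ : Measure ℝ) : Prop := σ (atoms σ)ᶜ = 0

/-- `σ` is purely atomic with exactly `m` atoms, where `m = ⊤` means infinitely many. -/
def IsPurelyAtomicWith (σ : Measure ℝ) (m : ℕ∞) : Prop :=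
  IsPurelyAtomic σ ∧ (atoms σ).encard = m

end CTQ

namespace CTQ

open Filter Topology

/-! With `m` atoms and `k ≥ 2m`, the product of the `(X - a) ^ 2` over the atoms is an admissible
test polynomial with integral zero, so every node of positive weight is an atom; a Lagrange-type
polynomial then fixes the total weight at each atom (`IsQuadratureFormula.node_mem`,
`IsQuadratureFormula.sum_weight_eq`). With equal weights each atom must have mass `c / n`, and the
claims on irrational and rational weights become arithmetic.

In the other case the moment vector is interior to the convex hull of the moment curve
(`momentVector_mem_interior`): a supporting hyperplane would give a nonzero non-negative polynomial
of degree at most `k` with integral zero, forcing `σ` onto its at most `k / 2` roots. An interior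
point leaves room to prescribe nodes, giving a positive quadrature with at least `k` distinct nodes
(`exists_positive_quadrature`). For large `n`, each weight is replaced by a tight cluster of about
`n * w i` distinct points. The small moment error is removed by translating whole clusters: there
are at least `k` translations for `k` moments, and their differential is onto by a Vandermonde
argument (`eventually_exists_shift`). -/

/-! ### From positive weights to equal weights -/

theorem exists_equiv_isChebyshevType {σ : Measure ℝ} {k n : ℕ} {κ : Type*} [Fintype κ]
    (hn : Fintype.card κ = n) (x : κ → ℝ)
    (hx : ∀ j ≤ k, ∫ t, t ^ j ∂σ = (1 / (n : ℝ)) * ∑ i, x i ^ j) :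
    ∃ e : Fin n ≃ κ, IsChebyshevType σ k (x ∘ e) := by
  have e : Fin n ≃ κ := (Fintype.equivFinOfCardEq hn).symm
  refine ⟨e, fun j hj => ?_⟩
  rw [hx j hj]
  congr 1
  exact (e.sum_comp (fun i => x i ^ j)).symm

/-- Probability weights can be approximated by fractions with any large denominator. -/
theorem exists_nat_approx {ι : Type*} [Fintype ι] (w : ι → ℝ) (hw : ∀ i, 0 ≤ w i)
    (hw1 : ∑ i, w i = 1) :
    ∃ m : ℕ → ι → ℕ, (∀ n, ∑ i, m n i = n) ∧
      ∀ i, Tendsto (fun n : ℕ => (m n i : ℝ) / n) atTop (𝓝 (w i)) := by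
  classical
  have hne : Nonempty ι := by
    by_contra h
    rw [not_nonempty_iff] at h
    simp at hw1
  obtain ⟨i₀⟩ := hne
  set f : ℕ → ι → ℕ := fun n i => ⌊w i * n⌋₊ with hf
  have hft : ∀ i, Tendsto (fun n : ℕ => (f n i : ℝ) / n) atTop (𝓝 (w i)) := fun i =>
    (tendsto_nat_floor_mul_div_atTop (hw i)).comp tendsto_natCast_atTop_atTop
  have hle : ∀ n, ∑ i ∈ Finset.univ.erase i₀, f n i ≤ n := by
    intro n
    have : (∑ i ∈ Finset.univ.erase i₀, f n i : ℝ) ≤ n := by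
      calc (∑ i ∈ Finset.univ.erase i₀, f n i : ℝ)
          ≤ ∑ i ∈ Finset.univ.erase i₀, w i * n :=
            Finset.sum_le_sum fun i _ => Nat.floor_le (mul_nonneg (hw i) n.cast_nonneg)
        _ ≤ ∑ i, w i * n := Finset.sum_le_sum_of_subset_of_nonneg (Finset.erase_subset _ _)
            fun i _ _ => mul_nonneg (hw i) n.cast_nonneg
        _ = n := by rw [← Finset.sum_mul, hw1, one_mul]
    exact_mod_cast this
  -- The index `i₀` absorbs the total rounding error, so that the sum is exactly `n`; `hle` keeps
  -- the subtraction from truncating.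
  refine ⟨fun n i => if i = i₀ then n - ∑ i ∈ Finset.univ.erase i₀, f n i else f n i, ?_, ?_⟩
  · intro n
    rw [← Finset.add_sum_erase _ _ (Finset.mem_univ i₀)]
    have h : ∑ i ∈ Finset.univ.erase i₀,
        (if i = i₀ then n - ∑ i ∈ Finset.univ.erase i₀, f n i else f n i) =
        ∑ i ∈ Finset.univ.erase i₀, f n i :=
      Finset.sum_congr rfl fun i hi => if_neg (Finset.ne_of_mem_erase hi)
    simp only [if_true]
    rw [h, Nat.sub_add_cancel (hle n)]
  · intro i
    by_cases hi : i = i₀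
    · subst hi
      have h1 : w i = 1 - ∑ j ∈ Finset.univ.erase i, w j := by
        rw [← hw1, ← Finset.add_sum_erase _ _ (Finset.mem_univ i)]; ring
      rw [h1]
      refine Tendsto.congr' ?_
        (tendsto_const_nhds.sub (tendsto_finsetSum (Finset.univ.erase i) fun j _ => hft j))
      filter_upwards [eventually_gt_atTop 0] with n hn
      have hn' : (n : ℝ) ≠ 0 := by positivity
      rw [if_pos rfl, Nat.cast_sub (hle n), sub_div, div_self hn', Nat.cast_sum,
        Finset.sum_div]
    · simpa only [if_neg hi] using hft i

/-- The `j`-th power sum of nodes `z i + s i + o`, where `q i a` is the `a`-th moment of the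
offsets `o` attached to `i`. -/
noncomputable def perturbedMoment {ι : Type*} [Fintype ι] (z : ι → ℝ) (k : ℕ)
    (q : ι → Fin (k + 1) → ℝ) (s : ι → ℝ) (j : ℕ) : ℝ :=
  ∑ i, ∑ a : Fin (k + 1), (j.choose a : ℝ) * (z i + s i) ^ (j - a : ℕ) * q i a

/-- The binomial theorem in the offsets. A cluster enters only through finitely many offset moments,
so clusters of varying size become points of one fixed finite-dimensional parameter space. -/
theorem perturbedMoment_eq {ι : Type*} [Fintype ι] (z : ι → ℝ) {k j : ℕ} (hj : j ≤ k)
    (s : ι → ℝ) {κ : ι → Type*} [∀ i, Fintype (κ i)] (o : ∀ i, κ i → ℝ) (c : ℝ) :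
    perturbedMoment z k (fun i a => c * ∑ l, o i l ^ (a : ℕ)) s j =
      c * ∑ p : (Σ i, κ i), (z p.1 + s p.1 + o p.1 p.2) ^ j := by
  rw [perturbedMoment, Fintype.sum_sigma, Finset.mul_sum]
  refine Finset.sum_congr rfl fun i _ => ?_
  have h : ∀ l, (z i + s i + o i l) ^ j =
      ∑ a : Fin (k + 1), (j.choose a : ℝ) * (z i + s i) ^ (j - a : ℕ) * o i l ^ (a : ℕ) := by
    intro l
    rw [Fin.sum_univ_eq_sum_range
      (fun a => (j.choose a : ℝ) * (z i + s i) ^ (j - a : ℕ) * o i l ^ (a : ℕ)), add_comm,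
      add_pow]
    -- The extra terms `a > j`, where `j - a` truncates, have vanishing binomial coefficient.
    rw [Finset.sum_subset (Finset.range_mono (show j + 1 ≤ k + 1 by omega))]
    · exact Finset.sum_congr rfl fun a _ => by ring
    · intro a _ ha
      rw [Nat.choose_eq_zero_of_lt (by simpa using ha)]
      simp
  simp_rw [h]
  rw [Finset.sum_comm, Finset.mul_sum]
  refine Finset.sum_congr rfl fun a _ => ?_
  rw [← Finset.mul_sum]
  ring

/-- The moments of `∑ i, w i • δ_i` as offset moments: all offsets vanish. -/
def unperturbed {ι : Type*} (w : ι → ℝ) (k : ℕ) : ι → Fin (k + 1) → ℝ :=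
  fun i a => if (a : ℕ) = 0 then w i else 0

theorem perturbedMoment_unperturbed {ι : Type*} [Fintype ι] (z w : ι → ℝ) (k j : ℕ)
    (s : ι → ℝ) :
    perturbedMoment z k (unperturbed w k) s j = ∑ i, w i * (z i + s i) ^ j := by
  refine Finset.sum_congr rfl fun i _ => ?_
  rw [Fin.sum_univ_succ]
  simp [unperturbed, mul_comm]

theorem linearMap_apply_eq_sum {k : ℕ} (f : (Fin k → ℝ) →ₗ[ℝ] ℝ) (v : Fin k → ℝ) :
    f v = ∑ j, v j * f (Pi.single j 1) := by
  rw [LinearMap.pi_apply_eq_sum_univ]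
  refine Finset.sum_congr rfl fun j _ => ?_
  rw [smul_eq_mul]
  congr 2
  ext i
  simp [Pi.single_apply, eq_comm]

/-- The differential of the moments with respect to the nodes is onto (Vandermonde). -/
theorem surjective_moment_derivative {ι : Type*} [Fintype ι] {k : ℕ} (z w : ι → ℝ)
    (hz : Function.Injective z) (hw : ∀ i, 0 < w i) (hk : k ≤ Fintype.card ι)
    (L : (ι → ℝ) →ₗ[ℝ] (Fin k → ℝ))
    (hL : ∀ s j, L s j = ∑ i, w i * ((j + 1 : ℕ) * z i ^ (j : ℕ) * s i)) :
    Function.Surjective L := by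
  classical
  -- By duality: a functional vanishing on the range gives a polynomial of degree below `k` with at
  -- least `k` roots.
  rw [← LinearMap.dualMap_injective_iff, injective_iff_map_eq_zero]
  intro f hf
  set c : Fin k → ℝ := fun j => f (Pi.single j 1) with hc
  have hfc : ∀ v, f v = ∑ j, v j * c j := linearMap_apply_eq_sum f
  set p : Polynomial ℝ :=
    ∑ j : Fin k, Polynomial.monomial (j : ℕ) (((j : ℕ) + 1 : ℕ) * c j) with hp
  have hpe : ∀ i, p.eval (z i) = 0 := by
    intro i
    have h := LinearMap.congr_fun hf (Pi.single i 1)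
    rw [LinearMap.dualMap_apply, hfc] at h
    simp only [hL, LinearMap.zero_apply, Pi.single_apply, mul_ite, mul_one, mul_zero,
      Finset.sum_ite_eq', Finset.mem_univ, if_true] at h
    have h2 : w i * p.eval (z i) = 0 := by
      rw [← h, hp, Polynomial.eval_finsetSum, Finset.mul_sum]
      refine Finset.sum_congr rfl fun j _ => ?_
      rw [Polynomial.eval_monomial]; ring
    exact (mul_eq_zero.mp h2).resolve_left (hw i).ne'
  have hp0 : p = 0 := by
    refine Polynomial.eq_zero_of_degree_lt_of_eval_index_eq_zero Finset.univ
      (v := z) hz.injOn ?_ fun i _ => hpe i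
    refine lt_of_lt_of_le ?_ (Nat.cast_le.mpr (by simpa using hk))
    rw [Polynomial.degree_lt_iff_coeff_zero]
    intro m hm
    rw [hp, Polynomial.finsetSum_coeff]
    exact Finset.sum_eq_zero fun j _ => by
      rw [Polynomial.coeff_monomial, if_neg (by have := j.2; omega)]
  have hc0 : ∀ j, c j = 0 := by
    intro j
    have h := congrArg (fun q => Polynomial.coeff q (j : ℕ)) hp0
    simp only [hp, Polynomial.finsetSum_coeff, Polynomial.coeff_monomial, Fin.val_inj,
      Finset.sum_ite_eq', Finset.mem_univ, if_true, Polynomial.coeff_zero] at h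
    exact (mul_eq_zero.mp h).resolve_left (by positivity)
  ext v
  simp [hfc, hc0]

/-- Small changes of the offset moments can be compensated by small shifts of the nodes. -/
theorem eventually_exists_shift {ι : Type*} [Fintype ι] {k : ℕ} (z w : ι → ℝ)
    (hz : Function.Injective z) (hw : ∀ i, 0 < w i) (hk : k ≤ Fintype.card ι)
    {δ : ℝ} (hδ : 0 < δ) :
    ∀ᶠ q in 𝓝 (unperturbed w k), ∃ s : ι → ℝ, (∀ i, |s i| < δ) ∧
      ∀ j : Fin k, perturbedMoment z k q s (j + 1) = ∑ i, w i * z i ^ ((j : ℕ) + 1) := by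
  set H : (ι → Fin (k + 1) → ℝ) × (ι → ℝ) → Fin k → ℝ :=
    fun p j => perturbedMoment z k p.1 p.2 (j + 1) with hH
  set p₀ : (ι → Fin (k + 1) → ℝ) × (ι → ℝ) := (unperturbed w k, 0) with hp₀
  have hHc : ContDiff ℝ 1 H := by
    rw [contDiff_pi]
    intro j
    simp only [hH, perturbedMoment]
    fun_prop
  have hHd : HasStrictFDerivAt H (fderiv ℝ H p₀) p₀ :=
    hHc.contDiffAt.hasStrictFDerivAt one_ne_zero
  set H' := fderiv ℝ H p₀
  -- Carrying the parameter `q` along, `(q, s) ↦ (q, H (q, s))` has surjective derivative and is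
  -- therefore open at `p₀`. This serves as an implicit function theorem without requiring
  -- uniqueness of `s`.
  have hG := (hasStrictFDerivAt_fst (𝕜 := ℝ) (p := p₀)).prodMk hHd
  have hB : ∀ (s : ι → ℝ) (j : Fin k),
      H' (0, s) j = ∑ i, w i * ((j + 1 : ℕ) * z i ^ (j : ℕ) * s i) := by
    intro s j
    have h1 : HasFDerivAt (fun s => H (unperturbed w k, s))
        (H'.comp (ContinuousLinearMap.inr ℝ _ _)) 0 :=
      HasFDerivAt.comp (0 : ι → ℝ) hHd.hasFDerivAt (hasFDerivAt_prodMk_right _ _)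
    have h2 := (hasFDerivAt_pi'.mp h1 j)
    have h3 : HasFDerivAt (fun s : ι → ℝ => ∑ i, w i * (z i + s i) ^ ((j : ℕ) + 1))
        (∑ i, w i • (((((j : ℕ) + 1 : ℕ) : ℝ) * (z i + 0) ^ (j : ℕ)) •
          (ContinuousLinearMap.proj i : (ι → ℝ) →L[ℝ] ℝ))) 0 := by
      refine HasFDerivAt.fun_sum fun i _ => ?_
      refine HasFDerivAt.const_mul ?_ (w i)
      have := ((hasFDerivAt_apply (𝕜 := ℝ) i (0 : ι → ℝ)).const_add (z i)).pow ((j : ℕ) + 1)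
      simpa using this
    have h4 : (fun s => H (unperturbed w k, s) j) =
        fun s : ι → ℝ => ∑ i, w i * (z i + s i) ^ ((j : ℕ) + 1) := by
      funext s
      exact perturbedMoment_unperturbed z w k _ s
    rw [h4] at h2
    have h5 := DFunLike.congr_fun (h2.unique h3) s
    simpa [_root_.sum_apply] using h5
  have hBs : Function.Surjective (H'.comp (ContinuousLinearMap.inr ℝ _ _)).toLinearMap :=
    surjective_moment_derivative z w hz hw hk _ fun s j => hB s j
  have hr := hG.map_nhds_eq_of_surj (by
    rw [LinearMap.range_eq_top]
    rintro ⟨u, v⟩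
    obtain ⟨s, hs⟩ := hBs (v - H' (u, 0))
    refine ⟨(u, s), Prod.ext rfl ?_⟩
    have h1 : H' (0, s) = v - H' (u, 0) := hs
    have h2 : H' (u, s) = H' (u, 0) + H' (0, s) := by
      rw [← map_add]; simp
    change H' (u, s) = v
    rw [h2, h1]; abel)
  have hU : {p : (ι → Fin (k + 1) → ℝ) × (ι → ℝ) | ∀ i, |p.2 i| < δ} ∈ 𝓝 p₀ := by
    have : ∀ i, ∀ᶠ p in 𝓝 p₀, |p.2 i| < δ := fun i => by
      have hcont : Continuous fun p : (ι → Fin (k + 1) → ℝ) × (ι → ℝ) => |p.2 i| := by fun_prop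
      exact hcont.tendsto p₀ |>.eventually_lt_const (by simpa [hp₀] using hδ)
    exact eventually_all.mpr this
  have himg := image_mem_map (m := fun p => (p.1, H p)) hU
  rw [hr] at himg
  have hcurve : Tendsto (fun q : ι → Fin (k + 1) → ℝ => (q, H p₀)) (𝓝 (unperturbed w k))
      (𝓝 (p₀.1, H p₀)) := by
    have : Continuous fun q : ι → Fin (k + 1) → ℝ => (q, H p₀) := by fun_prop
    exact this.tendsto _
  filter_upwards [hcurve himg] with q hq
  obtain ⟨⟨q', s⟩, hs, he⟩ := hq
  obtain ⟨rfl, he2⟩ := Prod.mk.inj he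
  refine ⟨s, hs, fun j => ?_⟩
  have := congrFun he2 j
  simp only [hH, hp₀] at this
  rw [this, perturbedMoment_unperturbed]
  simp

/-- A quadrature formula with positive weights and at least `k` distinct nodes can be replaced by
Chebyshev-type quadratures with any large number of distinct nodes. -/
theorem exists_injective_chebyshev {ι : Type*} [Fintype ι] {k : ℕ} (σ : Measure ℝ)
    [IsProbabilityMeasure σ] (z w : ι → ℝ)
    (hz : Function.Injective z) (hw : ∀ i, 0 < w i) (hk : k ≤ Fintype.card ι)
    (hm : ∀ j ≤ k, ∫ t, t ^ j ∂σ = ∑ i, w i * z i ^ j) :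
    ∃ n₀ : ℕ, ∀ n : ℕ, n₀ ≤ n →
      ∃ x : Fin n → ℝ, Function.Injective x ∧ IsChebyshevType σ k x := by
  have hw1 : ∑ i, w i = 1 := by simpa using (hm 0 (Nat.zero_le _)).symm
  obtain ⟨m, hmn, hmt⟩ := exists_nat_approx w (fun i => (hw i).le) hw1
  -- Two shifts and one difference of offsets, each below `δ`, cannot make different clusters meet.
  have hsep : ∃ δ : ℝ, 0 < δ ∧ ∀ i j, i ≠ j → 3 * δ < |z i - z j| := by
    have h : ∀ i j, i ≠ j → ∀ᶠ δ in 𝓝[>] (0 : ℝ), 3 * δ < |z i - z j| := by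
      intro i j hij
      have : Tendsto (fun δ : ℝ => 3 * δ) (𝓝[>] 0) (𝓝 0) := by
        have : Continuous fun δ : ℝ => 3 * δ := by fun_prop
        simpa using (this.tendsto 0).mono_left nhdsWithin_le_nhds
      exact this.eventually_lt_const (abs_pos.mpr (sub_ne_zero.mpr (hz.ne hij)))
    have h' : ∀ᶠ δ in 𝓝[>] (0 : ℝ), ∀ i j, i ≠ j → 3 * δ < |z i - z j| := by
      simp only [eventually_all]
      exact h
    obtain ⟨δ, h1, h2⟩ := (h'.and self_mem_nhdsWithin).exists
    exact ⟨δ, h2, h1⟩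
  obtain ⟨δ, hδ, hsep⟩ := hsep
  -- The spacing `1 / n ^ 2` separates the points of a cluster while its at most `n` points stay
  -- within `1 / n`.
  set o : ∀ n i, Fin (m n i) → ℝ := fun n _ l => (l : ℝ) / (n : ℝ) ^ 2 with ho
  have hmle : ∀ n i, m n i ≤ n := fun n i => by
    conv_rhs => rw [← hmn n]
    exact Finset.single_le_sum (fun _ _ => Nat.zero_le _) (Finset.mem_univ i)
  have ho0 : ∀ n i l, 0 ≤ o n i l := fun n i l => by simp only [ho]; positivity
  have hon : ∀ n i l, o n i l ≤ 1 / n := fun n i l => by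
    have hl : (l : ℝ) ≤ n := by exact_mod_cast l.2.le.trans (hmle n i)
    have hn : (0 : ℝ) < n := by
      have : 0 < n := lt_of_lt_of_le (Fin.pos l) (hmle n i)
      exact_mod_cast this
    simp only [ho]
    rw [div_le_div_iff₀ (by positivity) hn]
    nlinarith
  set q : ℕ → ι → Fin (k + 1) → ℝ :=
    fun n i a => 1 / (n : ℝ) * ∑ l, o n i l ^ (a : ℕ) with hq
  have hqt : Tendsto q atTop (𝓝 (unperturbed w k)) := by
    rw [tendsto_pi_nhds]
    intro i
    rw [tendsto_pi_nhds]
    intro a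
    by_cases ha : (a : ℕ) = 0
    · simp only [hq, unperturbed, ha, if_true, pow_zero, Finset.sum_const, Finset.card_univ,
        Fintype.card_fin, nsmul_eq_mul, mul_one]
      exact (hmt i).congr fun n => by ring
    · simp only [unperturbed, if_neg ha]
      refine squeeze_zero' (g := fun n : ℕ => 1 / (n : ℝ)) (Eventually.of_forall fun n => ?_) ?_
        tendsto_one_div_atTop_nhds_zero_nat
      · exact mul_nonneg (by positivity) (Finset.sum_nonneg fun l _ => pow_nonneg (ho0 n i l) _)
      · filter_upwards [eventually_gt_atTop 0] with n hn
        have hn' : (1 : ℝ) ≤ n := by exact_mod_cast hn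
        have hbd : ∑ l, o n i l ^ (a : ℕ) ≤ 1 := by
          calc ∑ l, o n i l ^ (a : ℕ) ≤ ∑ l : Fin (m n i), 1 / (n : ℝ) := by
                refine Finset.sum_le_sum fun l _ => ?_
                refine (pow_le_of_le_one (ho0 n i l) ((hon n i l).trans ?_) ha).trans (hon n i l)
                rw [div_le_one (by linarith)]; exact hn'
            _ ≤ 1 := by
                simp only [Finset.sum_const, Finset.card_univ, Fintype.card_fin, nsmul_eq_mul,
                  mul_one_div]
                rw [div_le_one (by linarith)]
                exact_mod_cast hmle n i
        calc 1 / (n : ℝ) * ∑ l, o n i l ^ (a : ℕ) ≤ 1 / (n : ℝ) * 1 := by gcongr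
          _ = 1 / (n : ℝ) := mul_one _
  have hev := hqt.eventually (eventually_exists_shift z w hz hw hk hδ)
  have hsmall : ∀ᶠ n : ℕ in atTop, 1 / (n : ℝ) < δ :=
    tendsto_one_div_atTop_nhds_zero_nat.eventually_lt_const hδ
  obtain ⟨n₀, hn₀⟩ := eventually_atTop.mp (hev.and (hsmall.and (eventually_gt_atTop 0)))
  refine ⟨n₀, fun n hn => ?_⟩
  obtain ⟨⟨s, hs, hsm⟩, hnδ, hnpos⟩ := hn₀ n hn
  have hnr : (n : ℝ) ≠ 0 := by positivity
  have hcard : Fintype.card (Σ i, Fin (m n i)) = n := by simp [hmn]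
  obtain ⟨e, he⟩ := exists_equiv_isChebyshevType (σ := σ) (k := k) hcard
    (fun p => z p.1 + s p.1 + o n p.1 p.2) (by
      intro j hj
      -- The shifts match only the moments of positive order; order zero is the node count.
      rcases j with _ | j
      · simp [hmn, hnr]
      · rw [← perturbedMoment_eq z hj s (o n) (1 / n), hm _ hj]
        exact (hsm ⟨j, hj⟩).symm)
  refine ⟨_, Function.Injective.comp ?_ e.injective, he⟩
  rintro ⟨i, l⟩ ⟨i', l'⟩ h
  simp only at h
  by_cases hi : i = i'
  · subst hi
    have h' : o n i l = o n i l' := by linarith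
    simp only [ho] at h'
    rw [div_left_inj' (by positivity)] at h'
    rw [Fin.ext (by exact_mod_cast h' : (l : ℕ) = l')]
  · exfalso
    have h1 := hsep i i' hi
    have h2 := abs_lt.mp (hs i)
    have h3 := abs_lt.mp (hs i')
    have h4 := ho0 n i l
    have h5 := ho0 n i' l'
    have h6 := (hon n i l).trans_lt hnδ
    have h7 := (hon n i' l').trans_lt hnδ
    have h8 : |z i - z i'| < 3 * δ := by
      rw [abs_lt]; constructor <;> linarith [h2.1, h2.2, h3.1, h3.2]
    linarith

/-! ### Polynomial integrals and non-negative polynomials -/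

theorem integrable_pow_of_le {σ : Measure ℝ} [IsFiniteMeasure σ] {k j : ℕ}
    (hσ : Integrable (fun t : ℝ => |t| ^ k) σ) (hj : j ≤ k) :
    Integrable (fun t : ℝ => t ^ j) σ := by
  refine Integrable.mono' (hσ.add (integrable_const (1 : ℝ)))
    (by fun_prop) (Eventually.of_forall fun t => ?_)
  rw [Real.norm_eq_abs, abs_pow, Pi.add_apply]
  rcases le_total |t| 1 with h | h
  · have := pow_le_one₀ (n := j) (abs_nonneg t) h
    have := pow_nonneg (abs_nonneg t) k
    linarith
  · have := pow_le_pow_right₀ h hj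
    linarith

theorem integrable_eval {σ : Measure ℝ} [IsFiniteMeasure σ] {k : ℕ}
    (hσ : Integrable (fun t : ℝ => |t| ^ k) σ) {p : Polynomial ℝ} (hp : p.natDegree ≤ k) :
    Integrable (fun t => p.eval t) σ := by
  simp only [Polynomial.eval_eq_sum_range]
  exact integrable_finsetSum _ fun j hj => (integrable_pow_of_le hσ (by
    have := Finset.mem_range.mp hj; omega)).const_mul _

theorem integral_eval {σ : Measure ℝ} [IsFiniteMeasure σ] {k : ℕ}
    (hσ : Integrable (fun t : ℝ => |t| ^ k) σ) {p : Polynomial ℝ} (hp : p.natDegree ≤ k) :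
    ∫ t, p.eval t ∂σ = ∑ j ∈ Finset.range (k + 1), p.coeff j * ∫ t, t ^ j ∂σ := by
  simp only [Polynomial.eval_eq_sum_range' (Nat.lt_succ_of_le hp)]
  rw [integral_finsetSum]
  · simp only [integral_const_mul]
  · exact fun j hj => (integrable_pow_of_le hσ (by
      have := Finset.mem_range.mp hj; omega)).const_mul _

theorem IsQuadratureFormula.integral_eval {σ : Measure ℝ} [IsFiniteMeasure σ] {k n : ℕ}
    {x w : Fin n → ℝ} (h : IsQuadratureFormula σ k x w)
    (hσ : Integrable (fun t : ℝ => |t| ^ k) σ) {p : Polynomial ℝ} (hp : p.natDegree ≤ k) :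
    ∫ t, p.eval t ∂σ = ∑ i, w i * p.eval (x i) := by
  rw [CTQ.integral_eval hσ hp]
  simp only [Polynomial.eval_eq_sum_range' (Nat.lt_succ_of_le hp), Finset.mul_sum]
  rw [Finset.sum_comm]
  refine Finset.sum_congr rfl fun j hj => ?_
  rw [h.moment_eq j (by have := Finset.mem_range.mp hj; omega), Finset.mul_sum]
  exact Finset.sum_congr rfl fun i _ => by ring

/-- A non-negative polynomial has at most half its degree many roots. -/
theorem two_mul_card_le_natDegree {p : Polynomial ℝ} (hp : p ≠ 0) (hnn : ∀ t, 0 ≤ p.eval t)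
    (S : Finset ℝ) (hS : ∀ a ∈ S, p.eval a = 0) : 2 * S.card ≤ p.natDegree := by
  have hle : S.val + S.val ≤ p.roots := by
    rw [Multiset.le_iff_count]
    intro a
    rw [Multiset.count_add, Polynomial.count_roots]
    have h1 : Multiset.count a S.val ≤ 1 := Multiset.nodup_iff_count_le_one.mp S.nodup a
    by_cases ha : a ∈ S
    -- A root of a non-negative polynomial is a minimum, hence at least a double root.
    · have hmin : IsLocalMin (fun t => p.eval t) a :=
        Eventually.of_forall fun t => by simpa only [hS a ha] using hnn t
      have hd : p.derivative.eval a = 0 := hmin.hasDerivAt_eq_zero (p.hasDerivAt a)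
      have := (Polynomial.one_lt_rootMultiplicity_iff_isRoot hp).mpr ⟨hS a ha, hd⟩
      omega
    · rw [Multiset.count_eq_zero_of_notMem (by simpa using ha)]
      simp
  have h := (Multiset.card_le_card hle).trans p.card_roots'
  rw [Multiset.card_add, Finset.card_val] at h
  omega

theorem measure_eval_ne_zero {σ : Measure ℝ} {p : Polynomial ℝ} (hnn : ∀ t, 0 ≤ p.eval t)
    (hi : Integrable (fun t => p.eval t) σ) (h0 : ∫ t, p.eval t ∂σ = 0) :
    σ {t | p.eval t ≠ 0} = 0 :=
  (integral_eq_zero_iff_of_nonneg hnn hi).mp h0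

/-- A measure carried by the roots of a polynomial is purely atomic. -/
theorem isPurelyAtomic_of_eval {σ : Measure ℝ} {p : Polynomial ℝ} (hp : p ≠ 0)
    (h0 : σ {t | p.eval t ≠ 0} = 0) :
    IsPurelyAtomic σ ∧ ∀ a ∈ atoms σ, p.eval a = 0 := by
  constructor
  · have hsub : (atoms σ)ᶜ ⊆ {t | p.eval t ≠ 0} ∪
        ⋃ a ∈ p.roots.toFinset.filter (fun a => σ {a} = 0), {a} := by
      intro a ha
      simp only [atoms, Set.mem_compl_iff, Set.mem_ofPred_eq, not_not] at ha
      by_cases h : p.eval a = 0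
      · right
        simp only [Set.mem_iUnion, Set.mem_singleton_iff, exists_prop, exists_eq_right',
          Finset.mem_filter, Multiset.mem_toFinset]
        exact ⟨(Polynomial.mem_roots hp).mpr h, ha⟩
      · exact Or.inl h
    refine measure_mono_null hsub (measure_union_null h0 ?_)
    exact (measure_biUnion_null_iff (Finset.countable_toSet _)).mpr
      fun a ha => (Finset.mem_filter.mp ha).2
  · intro a ha
    by_contra h
    exact ha (measure_mono_null (Set.singleton_subset_iff.mpr h) h0)

/-! ### The moment curve and its convex hull -/

/-- The curve `t ↦ (t, t ^ 2, …, t ^ k)`. -/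
def momentCurve (k : ℕ) (t : ℝ) : Fin k → ℝ := fun j => t ^ ((j : ℕ) + 1)

/-- The polynomial without constant term that a linear functional cuts out on the moment curve. -/
noncomputable def functionalPolynomial {k : ℕ} (f : (Fin k → ℝ) →ₗ[ℝ] ℝ) : Polynomial ℝ :=
  ∑ j : Fin k, Polynomial.monomial ((j : ℕ) + 1) (f (Pi.single j 1))

theorem eval_functionalPolynomial {k : ℕ} (f : (Fin k → ℝ) →ₗ[ℝ] ℝ) (t : ℝ) :
    (functionalPolynomial f).eval t = f (momentCurve k t) := by
  rw [linearMap_apply_eq_sum, functionalPolynomial, Polynomial.eval_finsetSum]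
  exact Finset.sum_congr rfl fun j _ => by
    rw [Polynomial.eval_monomial, momentCurve, mul_comm]

theorem natDegree_functionalPolynomial_le {k : ℕ} (f : (Fin k → ℝ) →ₗ[ℝ] ℝ) :
    (functionalPolynomial f).natDegree ≤ k :=
  Polynomial.natDegree_sum_le_of_forall_le _ _ fun j _ =>
    (Polynomial.natDegree_monomial_le _).trans j.2

theorem coeff_functionalPolynomial {k : ℕ} (f : (Fin k → ℝ) →ₗ[ℝ] ℝ) (j : Fin k) :
    (functionalPolynomial f).coeff ((j : ℕ) + 1) = f (Pi.single j 1) := by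
  simp [functionalPolynomial, Polynomial.finsetSum_coeff, Polynomial.coeff_monomial,
    Fin.val_inj]

/-- A linear functional is determined by its values on the moment curve up to a constant. -/
theorem eq_zero_of_functionalPolynomial_eq_C {k : ℕ} {f : (Fin k → ℝ) →ₗ[ℝ] ℝ} {c : ℝ}
    (h : functionalPolynomial f = Polynomial.C c) : f = 0 := by
  have h0 : ∀ j, f (Pi.single j 1) = 0 := fun j => by
    rw [← coeff_functionalPolynomial, h, Polynomial.coeff_C_succ]
  ext v
  simp [h0]

/-- Otherwise a nonzero functional would be constant on the curve, making a polynomial with its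
coefficients constant. -/
theorem interior_convexHull_momentCurve_nonempty (k : ℕ) :
    (interior (convexHull ℝ (Set.range (momentCurve k)))).Nonempty := by
  rw [interior_convexHull_nonempty_iff_affineSpan_eq_top,
    AffineSubspace.affineSpan_eq_top_iff_vectorSpan_eq_top_of_nonempty ℝ _ _
      (Set.range_nonempty _)]
  by_contra h
  obtain ⟨f, hf, hle⟩ := Submodule.exists_le_ker_of_lt_top _ (lt_top_iff_ne_top.mpr h)
  refine hf (eq_zero_of_functionalPolynomial_eq_C (c := f (momentCurve k 0)) ?_)
  refine Polynomial.funext fun t => ?_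
  rw [eval_functionalPolynomial, Polynomial.eval_C, ← sub_eq_zero, ← map_sub]
  exact hle (vsub_mem_vectorSpan ℝ (Set.mem_range_self t) (Set.mem_range_self 0))

/-- The vector of the first `k` moments. -/
noncomputable def momentVector (σ : Measure ℝ) (k : ℕ) : Fin k → ℝ :=
  fun j => ∫ t, t ^ ((j : ℕ) + 1) ∂σ

theorem integral_functionalPolynomial {σ : Measure ℝ} [IsFiniteMeasure σ] {k : ℕ}
    (hσ : Integrable (fun t : ℝ => |t| ^ k) σ) (f : (Fin k → ℝ) →ₗ[ℝ] ℝ) :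
    ∫ t, (functionalPolynomial f).eval t ∂σ = f (momentVector σ k) := by
  simp only [eval_functionalPolynomial, linearMap_apply_eq_sum f (momentCurve k _),
    linearMap_apply_eq_sum f (momentVector σ k)]
  rw [integral_finsetSum]
  · simp only [integral_mul_const, momentCurve, momentVector]
  · exact fun j _ => (integrable_pow_of_le hσ j.2).mul_const _

/-- Unless the measure has at most `k / 2` atoms and nothing else, its moment vector is an interior
point of the convex hull of the moment curve. -/
theorem momentVector_mem_interior {σ : Measure ℝ} [IsProbabilityMeasure σ] {k : ℕ}
    (hσ : Integrable (fun t : ℝ => |t| ^ k) σ)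
    (h : IsPurelyAtomic σ → ((k : ℕ∞) < 2 * (atoms σ).encard)) :
    momentVector σ k ∈ interior (convexHull ℝ (Set.range (momentCurve k))) := by
  by_contra hc
  -- The supporting functional yields `p = c - f` along the curve: non-negative, nonzero, and of
  -- integral zero because `c` is the value at the moment vector.
  obtain ⟨f, hf0, hf⟩ := geometric_hahn_banach_of_nonempty_interior_point
    (convex_convexHull ℝ _) hc (interior_convexHull_momentCurve_nonempty k)
  set c := f (momentVector σ k) with hcdef
  set p := Polynomial.C c - functionalPolynomial f.toLinearMap with hp
  have hpe : ∀ t, p.eval t = c - (functionalPolynomial f.toLinearMap).eval t := fun t => by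
    simp [hp]
  have hp0 : p ≠ 0 := fun h0 => hf0 (by
    have := eq_zero_of_functionalPolynomial_eq_C (sub_eq_zero.mp h0).symm
    exact ContinuousLinearMap.coe_injective this)
  have hnn : ∀ t, 0 ≤ p.eval t := fun t => by
    rw [hpe, eval_functionalPolynomial, sub_nonneg]
    exact hf _ (subset_convexHull ℝ _ (Set.mem_range_self t))
  have hdeg : p.natDegree ≤ k := (Polynomial.natDegree_sub_le _ _).trans
    (max_le (by simp) (natDegree_functionalPolynomial_le _))
  have hint : ∫ t, p.eval t ∂σ = 0 := by
    simp only [hpe]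
    rw [integral_sub (integrable_const c)
      (integrable_eval hσ (natDegree_functionalPolynomial_le _)),
      integral_functionalPolynomial hσ]
    simp [hcdef]
  obtain ⟨hat, hroot⟩ := isPurelyAtomic_of_eval hp0
    (measure_eval_ne_zero hnn (integrable_eval hσ hdeg) hint)
  have hfin : (atoms σ).Finite := p.roots.toFinset.finite_toSet.subset fun a ha => by
    simpa using (Polynomial.mem_roots hp0).mpr (hroot a ha)
  have hcard := (two_mul_card_le_natDegree hp0 hnn hfin.toFinset
    fun a ha => hroot a (by simpa using ha)).trans hdeg
  have hlt := h hat
  rw [hfin.encard_eq_coe_toFinset_card] at hlt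
  have : k < 2 * hfin.toFinset.card := by exact_mod_cast hlt
  omega

/-- Grouping equal nodes of a quadrature formula and dropping the zero weights. -/
theorem exists_finset_nodes {κ : Type*} [Fintype κ] (a t : κ → ℝ) (ha : ∀ i, 0 ≤ a i) :
    ∃ (Z : Finset ℝ) (w : ℝ → ℝ), (∀ z ∈ Z, 0 < w z) ∧ (∀ i, 0 < a i → t i ∈ Z) ∧
      ∀ g : ℝ → ℝ, ∑ z ∈ Z, w z * g z = ∑ i, a i * g (t i) := by
  classical
  refine ⟨(Finset.univ.filter fun i => 0 < a i).image t,
    fun z => ∑ i with t i = z, a i, ?_, ?_, ?_⟩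
  · intro z hz
    obtain ⟨i, hi, rfl⟩ := Finset.mem_image.mp hz
    exact Finset.sum_pos' (fun i _ => ha i) ⟨i, by simp, (Finset.mem_filter.mp hi).2⟩
  · exact fun i hi => Finset.mem_image_of_mem _ (by simpa using hi)
  · intro g
    have h : ∑ i, a i * g (t i) = ∑ i with 0 < a i, a i * g (t i) := by
      rw [Finset.sum_filter]
      refine Finset.sum_congr rfl fun i _ => ?_
      split_ifs with hi
      · rfl
      · rw [le_antisymm (not_lt.mp hi) (ha i), zero_mul]
    rw [h, ← Finset.sum_fiberwise_of_maps_to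
      (fun i hi => Finset.mem_image_of_mem t hi)]
    refine Finset.sum_congr rfl fun z _ => ?_
    rw [Finset.sum_mul, Finset.filter_filter]
    rw [Finset.sum_filter, Finset.sum_filter]
    refine Finset.sum_congr rfl fun i _ => ?_
    by_cases hz : t i = z
    · subst hz
      by_cases hi : 0 < a i
      · simp [hi]
      · simp [le_antisymm (not_lt.mp hi) (ha i)]
    · simp [hz]

/-- An interior point of the convex hull of the moment curve has a representation with at least `k`
nodes. -/
theorem exists_positive_quadrature {σ : Measure ℝ} [IsProbabilityMeasure σ] {k : ℕ} (hk : 1 ≤ k)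
    (h : momentVector σ k ∈ interior (convexHull ℝ (Set.range (momentCurve k)))) :
    ∃ (Z : Finset ℝ) (w : ℝ → ℝ), k ≤ Z.card ∧ (∀ z ∈ Z, 0 < w z) ∧
      ∀ j ≤ k, ∫ t, t ^ j ∂σ = ∑ z ∈ Z, w z * z ^ j := by
  set c := momentVector σ k
  -- The prescribed nodes are `0, …, k - 1`, with barycentre `b`. Pushing `c` slightly away from `b`
  -- stays in the hull, and `c` is then a convex combination of the pushed point and `b` in which
  -- each prescribed node has weight at least `η / k / (1 + η)`.
  set b : Fin k → ℝ := ∑ i : Fin k, (1 / (k : ℝ)) • momentCurve k (i : ℕ) with hb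
  have hkr : (k : ℝ) ≠ 0 := by positivity
  have hη : ∃ η : ℝ, 0 < η ∧ c + η • (c - b) ∈ convexHull ℝ (Set.range (momentCurve k)) := by
    have hcont : Continuous fun η : ℝ => c + η • (c - b) := by fun_prop
    have h1 : ∀ᶠ η in 𝓝 (0 : ℝ), c + η • (c - b) ∈
        interior (convexHull ℝ (Set.range (momentCurve k))) :=
      hcont.tendsto 0 |>.eventually (isOpen_interior.mem_nhds (by simpa using h))
    obtain ⟨η, h2, h3⟩ :=
      ((h1.filter_mono nhdsWithin_le_nhds).and (self_mem_nhdsWithin (s := Set.Ioi 0))).exists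
    exact ⟨η, h3, interior_subset h2⟩
  obtain ⟨η, hη, hmem⟩ := hη
  obtain ⟨ι, _, v, y, hv, hv1, hy, hvy⟩ := mem_convexHull_iff_exists_fintype.mp hmem
  choose t ht using hy
  have hc : ∀ j : Fin k, (1 + η) * c j =
      ∑ i, v i * t i ^ ((j : ℕ) + 1) + ∑ i : Fin k, η / k * ((i : ℕ) : ℝ) ^ ((j : ℕ) + 1) := by
    intro j
    have h1 := congrFun hvy j
    simp only [← ht, Finset.sum_apply, Pi.smul_apply, smul_eq_mul, Pi.add_apply, Pi.sub_apply, hb,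
      momentCurve] at h1
    rw [h1, ← Finset.mul_sum, ← Finset.mul_sum]
    ring
  obtain ⟨Z, w, hw, hZ, hg⟩ := exists_finset_nodes
    (Sum.elim (fun i => v i / (1 + η)) (fun _ : Fin k => η / k / (1 + η)))
    (Sum.elim t fun i : Fin k => ((i : ℕ) : ℝ))
    (by rintro (i | i)
        · exact div_nonneg (hv i) (by positivity)
        · simp only [Sum.elim_inr]; positivity)
  refine ⟨Z, w, ?_, hw, fun j hj => ?_⟩
  · calc k = (Finset.univ.image fun i : Fin k => ((i : ℕ) : ℝ)).card := by
          rw [Finset.card_image_of_injective _ fun i j hij => Fin.ext (Nat.cast_injective hij)]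
          simp
      _ ≤ Z.card := Finset.card_le_card fun x hx => by
          obtain ⟨i, -, rfl⟩ := Finset.mem_image.mp hx
          exact hZ (Sum.inr i) (by simp only [Sum.elim_inr]; positivity)
  · rw [hg fun z => z ^ j, Fintype.sum_sum_type]
    simp only [Sum.elim_inl, Sum.elim_inr]
    have h1 : (1 + η) ≠ 0 := by positivity
    rcases j with _ | j
    · simp only [pow_zero, mul_one, ← Finset.sum_div, hv1]
      simp
      field_simp
    · have h2 := hc ⟨j, hj⟩
      have h3 : ∫ x, x ^ (j + 1) ∂σ = c ⟨j, hj⟩ := rfl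
      rw [h3, ← mul_right_inj' h1, h2, mul_add, Finset.mul_sum, Finset.mul_sum]
      congr 1 <;> exact Finset.sum_congr rfl fun i _ => by field_simp

theorem exists_injective_chebyshev_of_atoms {σ : Measure ℝ} [IsProbabilityMeasure σ] {k : ℕ}
    (hk : 1 ≤ k) (hσ : Integrable (fun t : ℝ => |t| ^ k) σ)
    (h : IsPurelyAtomic σ → ((k : ℕ∞) < 2 * (atoms σ).encard)) :
    ∃ n₀ : ℕ, ∀ n : ℕ, n₀ ≤ n →
      ∃ x : Fin n → ℝ, Function.Injective x ∧ IsChebyshevType σ k x := by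
  obtain ⟨Z, w, hcard, hw, hm⟩ := exists_positive_quadrature hk (momentVector_mem_interior hσ h)
  refine exists_injective_chebyshev (ι := Z) σ (fun z => z) (fun z => w z)
    Subtype.val_injective (fun z => hw z z.2) (by simpa using hcard) fun j hj => ?_
  rw [hm j hj]
  exact (Finset.sum_coe_sort Z fun z => w z * z ^ j).symm

/-! ### Rigidity for finitely many atoms -/

theorem integral_eq_sum_of_null_compl {σ : Measure ℝ} [IsFiniteMeasure σ] {S : Finset ℝ}
    (hS : σ (S : Set ℝ)ᶜ = 0) (f : ℝ → ℝ) :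
    ∫ t, f t ∂σ = ∑ a ∈ S, σ.real {a} * f a := by
  have h : σ.restrict (S : Set ℝ) = σ :=
    Measure.restrict_eq_self_of_ae_mem (mem_ae_iff.mpr hS)
  conv_lhs => rw [← h]
  rw [setIntegral_finset]
  · simp only [smul_eq_mul]
  · exact IntegrableOn.finset

theorem measure_ext_of_null_compl {σ μ : Measure ℝ} {S : Finset ℝ}
    (hσ : σ (S : Set ℝ)ᶜ = 0) (hμ : μ (S : Set ℝ)ᶜ = 0) (h : ∀ a ∈ S, μ {a} = σ {a}) :
    μ = σ := by
  classical
  have key : ∀ ν : Measure ℝ, ν (S : Set ℝ)ᶜ = 0 → ∀ s : Set ℝ,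
      ν s = ∑ a ∈ S with a ∈ s, ν {a} := by
    intro ν hν s
    rw [sum_measure_singleton]
    rw [← measure_inter_add_sdiff s S.measurableSet,
      measure_mono_null (Set.sdiff_subset_compl s S) hν, add_zero]
    congr 1
    ext a
    simp [and_comm]
  ext s _
  rw [key μ hμ, key σ hσ]
  exact Finset.sum_congr rfl fun a ha => h a (Finset.mem_filter.mp ha).1

open Classical in
theorem discreteMeasure_apply {n : ℕ} (x w : Fin n → ℝ) (hw : ∀ i, 0 ≤ w i) {s : Set ℝ}
    (hs : MeasurableSet s) :
    discreteMeasure x w s = ENNReal.ofReal (∑ i with x i ∈ s, w i) := by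
  rw [discreteMeasure, Measure.finsetSum_apply, ENNReal.ofReal_sum_of_nonneg fun i _ => hw i,
    Finset.sum_filter]
  refine Finset.sum_congr rfl fun i _ => ?_
  rw [Measure.smul_apply, Measure.dirac_apply' _ hs]
  by_cases h : x i ∈ s <;> simp [h]

/-- The product of the squares `(X - a) ^ 2`. -/
noncomputable def squaredNodal (S : Finset ℝ) : Polynomial ℝ :=
  ∏ a ∈ S, (Polynomial.X - Polynomial.C a) ^ 2

theorem eval_squaredNodal (S : Finset ℝ) (t : ℝ) :
    (squaredNodal S).eval t = ∏ a ∈ S, (t - a) ^ 2 := by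
  simp [squaredNodal, Polynomial.eval_prod]

theorem natDegree_squaredNodal (S : Finset ℝ) : (squaredNodal S).natDegree = 2 * S.card := by
  rw [squaredNodal, Polynomial.natDegree_prod_of_monic _ _ fun a _ =>
    (Polynomial.monic_X_sub_C a).pow 2]
  simp [mul_comm]

theorem IsChebyshevType.isQuadratureFormula {σ : Measure ℝ} {k n : ℕ} {x : Fin n → ℝ}
    (h : IsChebyshevType σ k x) :
    IsQuadratureFormula σ k x fun _ => 1 / (n : ℝ) :=
  ⟨fun _ => by positivity, fun j hj => by rw [h j hj, Finset.mul_sum]⟩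

section FinitelyManyAtoms

variable {σ : Measure ℝ} [IsProbabilityMeasure σ] {k : ℕ} {S : Finset ℝ} {n : ℕ}
  {x w : Fin n → ℝ}

/-- The nodes of a quadrature formula of high degree lie among the atoms. -/
theorem IsQuadratureFormula.node_mem (h : IsQuadratureFormula σ k x w)
    (hσ : Integrable (fun t : ℝ => |t| ^ k) σ) (hS : σ (S : Set ℝ)ᶜ = 0)
    (hk : 2 * S.card ≤ k) (i : Fin n) (hi : x i ∉ S) : w i = 0 := by
  have h1 := h.integral_eval hσ (p := squaredNodal S) (by rwa [natDegree_squaredNodal])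
  rw [integral_eq_sum_of_null_compl hS, Finset.sum_eq_zero] at h1
  · have hnn : ∀ t, 0 ≤ (squaredNodal S).eval t := fun t => by
      rw [eval_squaredNodal]; exact Finset.prod_nonneg fun a _ => sq_nonneg _
    have h2 := (Finset.sum_eq_zero_iff_of_nonneg fun i _ =>
      mul_nonneg (h.weight_nonneg i) (hnn (x i))).mp h1.symm i (Finset.mem_univ i)
    refine (mul_eq_zero.mp h2).resolve_right ?_
    rw [eval_squaredNodal]
    exact Finset.prod_ne_zero_iff.mpr fun a ha => pow_ne_zero 2 (sub_ne_zero.mpr fun he => hi (he ▸ ha))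
  · intro a ha
    rw [eval_squaredNodal, Finset.prod_eq_zero ha (by simp), mul_zero]

/-- A quadrature formula of high degree reproduces the weights of the atoms. -/
theorem IsQuadratureFormula.sum_weight_eq (h : IsQuadratureFormula σ k x w)
    (hσ : Integrable (fun t : ℝ => |t| ^ k) σ) (hS : σ (S : Set ℝ)ᶜ = 0)
    (hk : 2 * S.card ≤ k) {a : ℝ} (ha : a ∈ S) :
    σ.real {a} = ∑ i with x i = a, w i := by
  -- An unnormalised Lagrange polynomial: among the points of `S` it sees only `a`.
  set p : Polynomial ℝ := ∏ b ∈ S.erase a, (Polynomial.X - Polynomial.C b) with hp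
  have hpe : ∀ t, p.eval t = ∏ b ∈ S.erase a, (t - b) := fun t => by
    simp [hp, Polynomial.eval_prod]
  have hdeg : p.natDegree ≤ k := by
    rw [hp, Polynomial.natDegree_prod_of_monic _ _ fun b _ => Polynomial.monic_X_sub_C b]
    simp only [Polynomial.natDegree_X_sub_C, Finset.sum_const, smul_eq_mul, mul_one]
    have := Finset.card_erase_le (s := S) (a := a)
    omega
  have hp0 : ∀ b ∈ S, b ≠ a → p.eval b = 0 := fun b hb hba => by
    rw [hpe, Finset.prod_eq_zero (Finset.mem_erase.mpr ⟨hba, hb⟩) (sub_self b)]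
  have hpa : p.eval a ≠ 0 := by
    rw [hpe, Finset.prod_ne_zero_iff]
    exact fun b hb => sub_ne_zero.mpr (Finset.ne_of_mem_erase hb).symm
  have h1 := h.integral_eval hσ hdeg
  rw [integral_eq_sum_of_null_compl hS, Finset.sum_eq_single_of_mem a ha
    fun b hb hba => by rw [hp0 b hb hba, mul_zero]] at h1
  refine mul_right_cancel₀ hpa (h1.trans ?_)
  rw [Finset.sum_mul, Finset.sum_filter]
  refine Finset.sum_congr rfl fun i _ => ?_
  split_ifs with hi
  · rw [hi]
  · by_cases hxS : x i ∈ S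
    · rw [hp0 _ hxS hi, mul_zero]
    · rw [h.node_mem hσ hS hk i hxS, zero_mul]

theorem IsQuadratureFormula.discreteMeasure_eq (h : IsQuadratureFormula σ k x w)
    (hσ : Integrable (fun t : ℝ => |t| ^ k) σ) (hS : σ (S : Set ℝ)ᶜ = 0)
    (hk : 2 * S.card ≤ k) : discreteMeasure x w = σ := by
  refine measure_ext_of_null_compl hS ?_ fun a ha => ?_
  · rw [discreteMeasure_apply x w h.weight_nonneg S.measurableSet.compl, Finset.sum_eq_zero,
      ENNReal.ofReal_zero]
    intro i hi
    exact h.node_mem hσ hS hk i (by simpa using hi)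
  · rw [discreteMeasure_apply x w h.weight_nonneg (measurableSet_singleton a)]
    have h1 := h.sum_weight_eq hσ hS hk ha
    rw [← ENNReal.ofReal_toReal (measure_ne_top σ {a}), ← measureReal_def, h1]
    simp

theorem quadratureMeasures_eq_singleton (hσ : Integrable (fun t : ℝ => |t| ^ k) σ)
    (hS : σ (S : Set ℝ)ᶜ = 0) (hk : 2 * S.card ≤ k) : quadratureMeasures σ k = {σ} := by
  ext μ
  constructor
  · rintro ⟨n, x, w, h, rfl⟩
    exact h.discreteMeasure_eq hσ hS hk
  · rintro rfl
    set e := S.equivFin.symm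
    have hq : IsQuadratureFormula μ k (fun i => (e i : ℝ)) fun i => μ.real {(e i : ℝ)} := by
      refine ⟨fun i => measureReal_nonneg, fun j _ => ?_⟩
      rw [integral_eq_sum_of_null_compl hS,
        e.sum_comp (fun a : S => μ.real {(a : ℝ)} * (a : ℝ) ^ j)]
      exact (Finset.sum_coe_sort S fun a => μ.real {a} * a ^ j).symm
    exact ⟨_, _, _, hq, (hq.discreteMeasure_eq hσ hS hk).symm⟩

/-- The number of nodes at an atom is determined by its weight. -/
theorem IsChebyshevType.card_eq (h : IsChebyshevType σ k x)
    (hσ : Integrable (fun t : ℝ => |t| ^ k) σ) (hS : σ (S : Set ℝ)ᶜ = 0)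
    (hk : 2 * S.card ≤ k) {a : ℝ} (ha : a ∈ S) :
    σ.real {a} = ((Finset.univ.filter fun i => x i = a).card : ℝ) / n := by
  rw [h.isQuadratureFormula.sum_weight_eq hσ hS hk ha]
  simp [div_eq_mul_inv]

theorem sum_real_eq_one (hS : σ (S : Set ℝ)ᶜ = 0) :
    ∑ a ∈ S, σ.real {a} = 1 := by
  simpa using (integral_eq_sum_of_null_compl hS fun _ => (1 : ℝ)).symm

/-- A measure with finitely many atoms of rational weights is itself an average of point masses. -/
theorem exists_chebyshev_of_rational (hS : σ (S : Set ℝ)ᶜ = 0)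
    (hq : ∀ a ∈ S, ∃ q : ℚ, σ.real {a} = q) : ∃ n, ExistsChebyshevType σ k n := by
  classical
  choose! q hq using hq
  -- A common denominator; `D` nodes suffice, with `D * σ.real {a}` of them at `a`.
  set D : ℕ := ∏ a ∈ S, (q a).den with hD
  have hDpos : 0 < D := Finset.prod_pos fun a _ => (q a).pos
  have hnum : ∀ a ∈ S, ∃ m : ℕ, (m : ℝ) = D * σ.real {a} := by
    intro a ha
    obtain ⟨d, hd⟩ := Finset.dvd_prod_of_mem (fun a => (q a).den) ha
    have hqn : 0 ≤ q a := by
      have : (0 : ℝ) ≤ q a := by rw [← hq a ha]; exact measureReal_nonneg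
      exact_mod_cast this
    have hden : ((q a).den : ℝ) ≠ 0 := by exact_mod_cast (q a).den_nz
    refine ⟨(q a).num.toNat * d, ?_⟩
    have hcast : (((q a).num.toNat : ℕ) : ℝ) = ((q a).num : ℝ) := by
      exact_mod_cast Int.toNat_of_nonneg (Rat.num_nonneg.mpr hqn)
    rw [hq a ha, hD, hd, Rat.cast_def]
    push_cast
    rw [hcast]
    field_simp
  choose! m hm using hnum
  have hDr : (D : ℝ) ≠ 0 := by positivity
  have hcard : Fintype.card (Σ a : S, Fin (m a)) = D := by
    have h : ((∑ a ∈ S, m a : ℕ) : ℝ) = D := by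
      rw [Nat.cast_sum, Finset.sum_congr rfl hm, ← Finset.mul_sum, sum_real_eq_one hS, mul_one]
    rw [Fintype.card_sigma]
    simp only [Fintype.card_fin]
    rw [Finset.sum_coe_sort S m]
    exact_mod_cast h
  obtain ⟨e, he⟩ := exists_equiv_isChebyshevType (σ := σ) (k := k) hcard
    (fun p => (p.1 : ℝ)) (fun j _ => by
      rw [integral_eq_sum_of_null_compl hS, Fintype.sum_sigma]
      simp only [Finset.sum_const, Finset.card_univ, Fintype.card_fin, nsmul_eq_mul]
      rw [Finset.sum_coe_sort S fun a => (m a : ℝ) * a ^ j, Finset.mul_sum]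
      refine Finset.sum_congr rfl fun a ha => ?_
      rw [hm a ha]
      field_simp)
  exact ⟨D, _, he⟩

/-- An atom of rational weight strictly between `0` and `1` excludes infinitely many numbers of
nodes. -/
theorem not_forall_existsChebyshevType (hσ : Integrable (fun t : ℝ => |t| ^ k) σ)
    (hS : σ (S : Set ℝ)ᶜ = 0) (hk : 2 * S.card ≤ k) {a : ℝ} (ha : a ∈ S) {q : ℚ}
    (hq : σ.real {a} = q) (h0 : 0 < σ.real {a}) (h1 : σ.real {a} < 1) (N : ℕ) :
    ¬ ∀ n, N ≤ n → ExistsChebyshevType σ k n := by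
  intro h
  -- With this many nodes the count at `a` is `N * q.num + q`, so `q` would be an integer strictly
  -- between `0` and `1`.
  obtain ⟨x, hx⟩ := h (N * q.den + 1) (by nlinarith [Nat.mul_le_mul_left N q.pos])
  have hc := hx.card_eq hσ hS hk ha
  rw [eq_div_iff (by positivity)] at hc
  set c := (Finset.univ.filter fun i => x i = a).card
  have hqd : σ.real {a} * q.den = q.num := by
    rw [hq]; exact_mod_cast Rat.mul_den_eq_num q
  have h2 : σ.real {a} = ((c - N * q.num : ℤ) : ℝ) := by
    push_cast at hc ⊢
    rw [← hc, ← hqd]; ring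
  rw [h2] at h0 h1
  have h3 : 0 < (c - N * q.num : ℤ) := by exact_mod_cast h0
  have h4 : (c - N * q.num : ℤ) < 1 := by exact_mod_cast h1
  omega

end FinitelyManyAtoms

/-! ### Minimal node counts and the theorem -/

theorem minNodes_lt_top_of_exists {σ : Measure ℝ} {k : ℕ} (h : ∃ n, ExistsChebyshevType σ k n) :
    minNodes σ k < ⊤ := by
  obtain ⟨n, hn⟩ := h
  exact (iInf₂_le n hn).trans_lt (ENat.natCast_lt_top n)

theorem minNodes_eq_top {σ : Measure ℝ} {k : ℕ} (h : ∀ n, ¬ ExistsChebyshevType σ k n) :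
    minNodes σ k = ⊤ := by
  simp [minNodes, h]

theorem minNodesFrom_lt_top {σ : Measure ℝ} {k : ℕ} (N : ℕ)
    (h : ∀ n, N ≤ n → ExistsChebyshevType σ k n) : minNodesFrom σ k < ⊤ :=
  (iInf₂_le N h).trans_lt (ENat.natCast_lt_top N)

theorem minNodesFrom_eq_top {σ : Measure ℝ} {k : ℕ}
    (h : ∀ N, ¬ ∀ n, N ≤ n → ExistsChebyshevType σ k n) : minNodesFrom σ k = ⊤ := by
  refine iInf_eq_top.mpr fun N => iInf_eq_top.mpr fun hN => absurd hN (h N)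

/-- A point mass is a Chebyshev-type quadrature with any positive number of nodes. -/
theorem minNodesFrom_eq_one {σ : Measure ℝ} [IsProbabilityMeasure σ] {k : ℕ} {a : ℝ}
    (hS : σ (({a} : Finset ℝ) : Set ℝ)ᶜ = 0) : minNodesFrom σ k = 1 := by
  have hone := sum_real_eq_one hS
  rw [Finset.sum_singleton] at hone
  have hall : ∀ n, 1 ≤ n → ExistsChebyshevType σ k n := by
    refine fun n hn => ⟨fun _ => a, fun j _ => ?_⟩
    have : (n : ℝ) ≠ 0 := by positivity
    rw [integral_eq_sum_of_null_compl hS]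
    simp [hone, this]
  refine le_antisymm ((iInf₂_le 1 hall).trans (by simp)) ?_
  refine le_iInf₂ fun N hN => ?_
  by_contra hlt
  have hN0 : N = 0 := by
    have : N < 1 := by exact_mod_cast not_le.mp hlt
    omega
  -- With no nodes the moment identity of order zero reads `1 = 0`.
  obtain ⟨x, hx⟩ := hN 0 hN0.le
  have := hx 0 (Nat.zero_le k)
  simp at this

end CTQ

theorem theorem1p1 (k : ℕ) (hk : 1 ≤ k) (σ : Measure ℝ) [IsProbabilityMeasure σ]
    (hσ : Integrable (fun t : ℝ => |t| ^ k) σ) :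
    (∀ m : ℕ, CTQ.IsPurelyAtomicWith σ m → 2 * m ≤ k →
      CTQ.quadratureMeasures σ k = {σ} ∧
      ((∃ x ∈ CTQ.atoms σ, Irrational (σ.real {x})) →
        CTQ.minNodes σ k = ⊤ ∧ CTQ.minNodesFrom σ k = ⊤) ∧
      ((∀ x ∈ CTQ.atoms σ, ∃ q : ℚ, σ.real {x} = q) →
        CTQ.minNodes σ k < ⊤ ∧
        (2 ≤ m → CTQ.minNodesFrom σ k = ⊤) ∧
        (m = 1 → CTQ.minNodesFrom σ k = 1))) ∧
    ((¬ CTQ.IsPurelyAtomic σ ∨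
        ∃ m : ℕ∞, CTQ.IsPurelyAtomicWith σ m ∧ (k : ℕ∞) < 2 * m) →
      CTQ.minNodesFrom σ k < ⊤ ∧
      ∃ n₀ : ℕ, ∀ n : ℕ, n₀ ≤ n →
        ∃ x : Fin n → ℝ, Function.Injective x ∧ CTQ.IsChebyshevType σ k x) := by
  constructor
  · rintro m ⟨hpure, hcard⟩ hmk
    have hfin : (CTQ.atoms σ).Finite := Set.finite_of_encard_eq_coe hcard
    obtain ⟨S, hS⟩ := hfin.exists_finset_coe
    have hmem : ∀ a, a ∈ CTQ.atoms σ ↔ a ∈ S := fun a => by rw [← hS, Finset.mem_coe]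
    have hnull : σ (S : Set ℝ)ᶜ = 0 := by rw [hS]; exact hpure
    have hSm : S.card = m := by
      rw [← hS, Set.encard_coe_eq_coe_finsetCard] at hcard
      exact_mod_cast hcard
    have hSk : 2 * S.card ≤ k := by omega
    have hone := CTQ.sum_real_eq_one hnull
    have hpos : ∀ a ∈ S, 0 < σ.real {a} := fun a ha =>
      ENNReal.toReal_pos ((hmem a).mpr ha) (measure_ne_top _ _)
    refine ⟨CTQ.quadratureMeasures_eq_singleton hσ hnull hSk, ?_, fun hrat => ⟨?_, ?_, ?_⟩⟩
    · rintro ⟨a, ha, hirr⟩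
      have hno : ∀ n, ¬ CTQ.ExistsChebyshevType σ k n := by
        rintro n ⟨x, hx⟩
        refine hirr ⟨((Finset.univ.filter fun i => x i = a).card : ℚ) / n, ?_⟩
        rw [hx.card_eq hσ hnull hSk ((hmem a).mp ha)]
        push_cast
        rfl
      exact ⟨CTQ.minNodes_eq_top hno, CTQ.minNodesFrom_eq_top fun N h => hno N (h N le_rfl)⟩
    · exact CTQ.minNodes_lt_top_of_exists
        (CTQ.exists_chebyshev_of_rational hnull fun a ha => hrat a ((hmem a).mpr ha))
    · intro hm2
      obtain ⟨a, ha, b, hb, hab⟩ := Finset.one_lt_card.mp (show 1 < S.card by omega)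
      obtain ⟨q, hq⟩ := hrat a ((hmem a).mpr ha)
      have hlt : σ.real {a} < 1 := by
        rw [← hone]
        exact Finset.single_lt_sum hab.symm ha hb (hpos b hb) fun c hc _ => (hpos c hc).le
      exact CTQ.minNodesFrom_eq_top
        (CTQ.not_forall_existsChebyshevType hσ hnull hSk ha hq (hpos a ha) hlt)
    · intro hm1
      obtain ⟨a, rfl⟩ := Finset.card_eq_one.mp (hSm.trans hm1)
      exact CTQ.minNodesFrom_eq_one hnull
  · intro h
    have hat : CTQ.IsPurelyAtomic σ → (k : ℕ∞) < 2 * (CTQ.atoms σ).encard := by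
      intro hpure
      rcases h with h | ⟨m, ⟨-, hm⟩, hlt⟩
      · exact absurd hpure h
      · rwa [hm]
    obtain ⟨n₀, hn₀⟩ := CTQ.exists_injective_chebyshev_of_atoms hk hσ hat
    exact ⟨CTQ.minNodesFrom_lt_top n₀ fun n hn =>
      let ⟨x, _, hx⟩ := hn₀ n hn; ⟨x, hx⟩, n₀, hn₀⟩
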